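/- **Setting.** Let $x_1,\dots,x_m\in\mathbb R^p$, labels $b\in\{1,-1\}^m$, $\bar x_i=b_ix_i$, let $\overline X$ be the $m\times p$ matrix with rows $\bar x_i$ and columns $\bar x^1,\dots,\bar x^p$. For $\lambda>0$ let $(\beta^*_\lambda,c^*_\lambda)$ denote any minimizer over $\mathbb R^p\times\mathbb R$ of $$\frac1m\sum_{i=1}^m\log\bigl(1+\exp(-\langle\beta,\bar x_i\rangle-b_ic)\bigr)+\lambda\|\beta\|_1,$$ and let $\theta^*_\lambda$ denote a minimizer of $g(\theta)=\frac1m\sum_{i=1}^m[\theta_i\log\theta_i+(1-\theta_i)\log(1-\theta_i)]$ over all $\theta\in(0,1)^m$ with $\|\overline X^T\theta\|_\infty\le m\lambda$ and $\langle\theta,b\rangle=0$. Let $m^+,m^-$ be the numbers of labels equal to $1$ and $-1$, let $\theta_{\max}\in\mathbb R^m$ have entries $m^- /m$ where $b_i=1$ and $m^+/m$ where $b_i=-1$, and let $\lambda_{\max}=\frac1m\|\overline X^T\theta_{\max}\|_\infty$. Put $\mathbf Pv=v-\frac{\langle v,b\rangle}{\|b\|_2^2}b$. Given $\lambda_0>\lambda>0$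 and $\theta^*_{\lambda_0}$, put $$r=\sqrt{\tfrac m2\Bigl[g\bigl(\tfrac{\lambda}{\lambda_0}\theta^*_{\lambda_0}\bigr)-g(\theta^*_{\lambda_0})+\bigl(1-\tfrac\lambda{\lambda_0}\bigr)\langle\nabla g(\theta^*_{\lambda_0}),\theta^*_{\lambda_0}\rangle\Bigr]},$$ pick any index $j_0$ with $|\langle\theta^*_{\lambda_0},\bar x^{j_0}\rangle|=m\lambda_0$, put $\bar x^*=\operatorname{sign}(\langle\theta^*_{\lambda_0},\bar x^{j_0}\rangle)\,\bar x^{j_0}$, and for $\xi\in\{1,-1\}$ let $$T_\xi(\theta^*_\lambda,\bar x^j;\theta^*_{\lambda_0})=\max\bigl\{\langle\theta,\xi\bar x^j\rangle:\ \|\theta-\theta^*_{\lambda_0}\|_2^2\le r^2,\ \langle\theta,b\rangle=0,\ \langle\theta,\bar x^*\rangle\le m\lambda\bigr\}.$$ **Theorem (Slores).** Let $\lambda>0$. 1. If $\lambda\ge\lambda_{\max}$, then $\beta^*_\lambda=0$. 2. Let $\lambda_{\max}\ge\lambda_0>\lambda>0$ and let $\theta^*_{\lambda_0}$ be given. Then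 an index $j_0$ as above exists, and for every $j\in\{1,\dots,p\}$ and every choice of $j_0$ the maxima $T_{\pm1}(\theta^*_\lambda,\bar x^j;\theta^*_{\lambda_0})$ are attained. If either (a) $\mathbf P\bar x^j=0$, or (b) $\max\{T_\xi(\theta^*_\lambda,\bar x^j;\theta^*_{\lambda_0}):\xi=\pm1\}<m\lambda$, then $[\beta^*_\lambda]_j=0$. Moreover, in the situation of part 2, if $\mathbf P\bar x^j\ne0$ then $T_\xi$ has the following closed form. Put $\bar x=-\xi\bar x^j$ and $d=\frac{m(\lambda_0-\lambda)}{r\|\mathbf P\bar x^*\|_2}$. If $\frac{\langle\mathbf P\bar x,\mathbf P\bar x^*\rangle}{\|\mathbf P\bar x\|_2\|\mathbf P\bar x^*\|_2}\ge d$, then $$T_\xi=r\|\mathbf P\bar x\|_2-\langle\theta^*_{\lambda_0},\bar x\rangle;$$ otherwise $$T_\xi=r\|\mathbf P\bar x+u_2^*\mathbf P\bar x^*\|_2-u_2^*m(\lambda_0-\lambda)-\langle\theta^*_{\lambda_0},\bar x\rangle,$$ where $u_2^*=\frac{-a_1+\sqrt\Delta}{2a_2}$, $a_2=\|\mathbf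 P\bar x^*\|_2^4(1-d^2)$, $a_1=2\langle\mathbf P\bar x,\mathbf P\bar x^*\rangle\|\mathbf P\bar x^*\|_2^2(1-d^2)$, $a_0=\langle\mathbf P\bar x,\mathbf P\bar x^*\rangle^2-d^2\|\mathbf P\bar x\|_2^2\|\mathbf P\bar x^*\|_2^2$ and $\Delta=a_1^2-4a_2a_0$. -/

import Mathlib

open scoped Gradient

noncomputable section

namespace Slores

variable {m p : ℕ}

/-- The label-weighted sample `x̄ᵢ = bᵢ xᵢ` (the `i`-th row of `X̄`). -/
def xbarRow (x : Fin m → EuclideanSpace ℝ (Fin p)) (b : EuclideanSpace ℝ (Fin m))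
    (i : Fin m) : EuclideanSpace ℝ (Fin p) :=
  b i • x i

/-- The `j`-th feature `x̄ʲ` (the `j`-th column of `X̄`). -/
def xbarCol (x : Fin m → EuclideanSpace ℝ (Fin p)) (b : EuclideanSpace ℝ (Fin m))
    (j : Fin p) : EuclideanSpace ℝ (Fin m) :=
  WithLp.toLp 2 fun i => xbarRow x b i j

/-- The objective of `ℓ₁`-regularized logistic regression. -/
def primalObj (x : Fin m → EuclideanSpace ℝ (Fin p)) (b : EuclideanSpace ℝ (Fin m))
    (lam : ℝ) (β : EuclideanSpace ℝ (Fin p)) (c : ℝ) : ℝ :=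
  1 / (m : ℝ) * ∑ i, Real.log (1 + Real.exp (-(inner ℝ β (xbarRow x b i)) - b i * c))
    + lam * ∑ j, |β j|

/-- `(β, c)` is a minimizer of the primal problem with parameter `lam`. -/
def IsPrimalOptimal (x : Fin m → EuclideanSpace ℝ (Fin p)) (b : EuclideanSpace ℝ (Fin m))
    (lam : ℝ) (β : EuclideanSpace ℝ (Fin p)) (c : ℝ) : Prop :=
  ∀ (β' : EuclideanSpace ℝ (Fin p)) (c' : ℝ), primalObj x b lam β c ≤ primalObj x b lam β' c'

/-- The dual objective `g(θ) = (1/m) ∑ᵢ (θᵢ log θᵢ + (1 - θᵢ) log (1 - θᵢ))`. -/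
def dualObj (θ : EuclideanSpace ℝ (Fin m)) : ℝ :=
  1 / (m : ℝ) * ∑ i, (θ i * Real.log (θ i) + (1 - θ i) * Real.log (1 - θ i))

/-- `‖X̄ᵀ θ‖_∞` (the norm on `Fin p → ℝ` is the maximum norm). -/
def corrNorm (x : Fin m → EuclideanSpace ℝ (Fin p)) (b : EuclideanSpace ℝ (Fin m))
    (θ : EuclideanSpace ℝ (Fin m)) : ℝ :=
  ‖(fun j => inner ℝ θ (xbarCol x b j) : Fin p → ℝ)‖

/-- The feasible set of the dual problem with parameter `lam`. -/
def dualFeasible (x : Fin m → EuclideanSpace ℝ (Fin p)) (b : EuclideanSpace ℝ (Fin m))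
    (lam : ℝ) : Set (EuclideanSpace ℝ (Fin m)) :=
  {θ | corrNorm x b θ ≤ m * lam ∧ inner ℝ θ b = 0 ∧ ∀ i, θ i ∈ Set.Ioo (0 : ℝ) 1}

/-- `θ` is a minimizer of the dual problem with parameter `lam`. -/
def IsDualOptimal (x : Fin m → EuclideanSpace ℝ (Fin p)) (b : EuclideanSpace ℝ (Fin m))
    (lam : ℝ) (θ : EuclideanSpace ℝ (Fin m)) : Prop :=
  θ ∈ dualFeasible x b lam ∧ IsMinOn dualObj (dualFeasible x b lam) θ

/-- The number of samples with label `1`. -/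
def mPlus (b : EuclideanSpace ℝ (Fin m)) : ℕ := (Finset.univ.filter fun i => b i = 1).card

/-- The number of samples with label `-1`. -/
def mMinus (b : EuclideanSpace ℝ (Fin m)) : ℕ := (Finset.univ.filter fun i => b i = -1).card

/-- The vector with entries `m⁻/m` where the label is `1` and `m⁺/m` where it is `-1`. -/
def thetaMax (b : EuclideanSpace ℝ (Fin m)) : EuclideanSpace ℝ (Fin m) :=
  WithLp.toLp 2 fun i => if b i = 1 then (mMinus b : ℝ) / m else (mPlus b : ℝ) / m

/-- `λ_max = (1/m) ‖X̄ᵀ θ_max‖_∞`. -/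
def lambdaMax (x : Fin m → EuclideanSpace ℝ (Fin p)) (b : EuclideanSpace ℝ (Fin m)) : ℝ :=
  1 / (m : ℝ) * corrNorm x b (thetaMax b)

/-- The projection onto the orthogonal complement of the span of `b`. -/
def proj (b v : EuclideanSpace ℝ (Fin m)) : EuclideanSpace ℝ (Fin m) :=
  v - (inner ℝ v b / ‖b‖ ^ 2) • b

/-- The active set `{j : |⟨θ, x̄ʲ⟩| = m lam}`. -/
def activeSet (x : Fin m → EuclideanSpace ℝ (Fin p)) (b : EuclideanSpace ℝ (Fin m))
    (lam : ℝ) (θ : EuclideanSpace ℝ (Fin m)) : Set (Fin p) :=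
  {j | |inner ℝ θ (xbarCol x b j)| = m * lam}

/-- `x̄* = sign(⟨θ₀, x̄^{j₀}⟩) x̄^{j₀}`. -/
def xstar (x : Fin m → EuclideanSpace ℝ (Fin p)) (b θ₀ : EuclideanSpace ℝ (Fin m))
    (j₀ : Fin p) : EuclideanSpace ℝ (Fin m) :=
  Real.sign (inner ℝ θ₀ (xbarCol x b j₀)) • xbarCol x b j₀

/-- The radius `r` of the ball around `θ₀`. -/
def radius (lam₀ lam : ℝ) (θ₀ : EuclideanSpace ℝ (Fin m)) : ℝ :=
  Real.sqrt ((m : ℝ) / 2 * (dualObj ((lam / lam₀) • θ₀) - dualObj θ₀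
    + (1 - lam / lam₀) * inner ℝ (∇ dualObj θ₀) θ₀))

/-- The region `𝒜` built from `θ₀` and the active index `j₀`. -/
def region (x : Fin m → EuclideanSpace ℝ (Fin p)) (b : EuclideanSpace ℝ (Fin m))
    (lam₀ lam : ℝ) (θ₀ : EuclideanSpace ℝ (Fin m)) (j₀ : Fin p) :
    Set (EuclideanSpace ℝ (Fin m)) :=
  {θ | ‖θ - θ₀‖ ^ 2 ≤ radius lam₀ lam θ₀ ^ 2 ∧ inner ℝ θ b = 0 ∧
    inner ℝ θ (xstar x b θ₀ j₀) ≤ m * lam}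

/-- The values `⟨θ, ξ x̄ʲ⟩`, `θ ∈ 𝒜`, whose maximum is `T_ξ`. -/
def boundValues (x : Fin m → EuclideanSpace ℝ (Fin p)) (b : EuclideanSpace ℝ (Fin m))
    (lam₀ lam : ℝ) (θ₀ : EuclideanSpace ℝ (Fin m)) (j₀ : Fin p) (ξ : ℝ) (j : Fin p) : Set ℝ :=
  (fun θ => inner ℝ θ (ξ • xbarCol x b j)) '' region x b lam₀ lam θ₀ j₀

/-- `T_ξ = max_{θ ∈ 𝒜} ⟨θ, ξ x̄ʲ⟩`. -/
def T (x : Fin m → EuclideanSpace ℝ (Fin p)) (b : EuclideanSpace ℝ (Fin m))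
    (lam₀ lam : ℝ) (θ₀ : EuclideanSpace ℝ (Fin m)) (j₀ : Fin p) (ξ : ℝ) (j : Fin p) : ℝ :=
  sSup (boundValues x b lam₀ lam θ₀ j₀ ξ j)

open Classical in
/-- The closed-form expression for `T_ξ`, valid when `P x̄ʲ ≠ 0`. -/
def closedForm (x : Fin m → EuclideanSpace ℝ (Fin p)) (b : EuclideanSpace ℝ (Fin m))
    (lam₀ lam : ℝ) (θ₀ : EuclideanSpace ℝ (Fin m)) (j₀ : Fin p) (ξ : ℝ) (j : Fin p) : ℝ :=
  let r := radius lam₀ lam θ₀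
  let xb := -(ξ • xbarCol x b j)
  let Px := proj b xb
  let Ps := proj b (xstar x b θ₀ j₀)
  let d := m * (lam₀ - lam) / (r * ‖Ps‖)
  let a₂ := ‖Ps‖ ^ 4 * (1 - d ^ 2)
  let a₁ := 2 * inner ℝ Px Ps * ‖Ps‖ ^ 2 * (1 - d ^ 2)
  let a₀ := (inner ℝ Px Ps) ^ 2 - d ^ 2 * ‖Px‖ ^ 2 * ‖Ps‖ ^ 2
  let Δ := a₁ ^ 2 - 4 * a₂ * a₀
  let u₂ := (-a₁ + Real.sqrt Δ) / (2 * a₂)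
  if d ≤ inner ℝ Px Ps / (‖Px‖ * ‖Ps‖) then
    r * ‖Px‖ - inner ℝ θ₀ xb
  else
    r * ‖Px + u₂ • Ps‖ - u₂ * m * (lam₀ - lam) - inner ℝ θ₀ xb

end Slores

end

noncomputable section

namespace Slores

variable {m p : ℕ}

open Filter Topology Set

/-! A primal minimizer `(β, c)` yields `θ = dualPoint x b β c`, the sigmoid of minus the margins.
The primal first-order conditions say that `θ` is dual feasible and that `β j * ⟨θ, x̄ʲ⟩ = m * lam *
|β j|`. Hence `|⟨θ, x̄ʲ⟩| < m * lam` forces `β j = 0`, and screening amounts to locating `θ`.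

The location comes from strong convexity: `1/t + 1/(1-t) ≥ 4` makes `g` strongly convex with modulus
`4/m`, so `(2/m)‖θ - θ₀‖² ≤ g θ - g θ₀ - ⟨∇g θ₀, θ - θ₀⟩`. With `s = lam/lam₀`, the point `s • θ₀`
is feasible for `lam`, so `g θ ≤ g (s • θ₀)`; and `s⁻¹ • θ` satisfies the linear constraints for
`lam₀`, so `⟨∇g θ₀, s⁻¹ • θ - θ₀⟩ ≥ 0`. Together these give the ball of radius `r`; the half-space
is feasibility of `θ` at `j₀` (`dualPoint_mem_region`).

The vector `thetaMax` minimizes `g` on the label hyperplane. If it is feasible it equals `θ`, and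
then `β = 0`; if `lam₀ ≤ lambdaMax`, some correlation constraint is tight at `θ₀`.

For the closed form, `δ = θ₀ - θ` ranges over a ball cut by a half-space; Lagrange relaxation bounds
the maximum, and an explicit multiplier attains the bound (`halfBall_max`). -/

/-! ### Binary entropy in one variable -/

theorem hasDerivAt_logit {y : ℝ} (h0 : y ≠ 0) (h1 : 1 - y ≠ 0) :
    HasDerivAt (fun t : ℝ => Real.log t - Real.log (1 - t)) (1 / y + 1 / (1 - y)) y := by
  have h := (Real.hasDerivAt_log h0).sub (((hasDerivAt_id y).const_sub 1).log h1)
  refine h.congr_deriv ?_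
  simp only [id]
  field_simp
  ring

theorem hasDerivAt_negEntropy {y : ℝ} (h0 : y ≠ 0) (h1 : 1 - y ≠ 0) :
    HasDerivAt (fun t : ℝ => t * Real.log t + (1 - t) * Real.log (1 - t))
      (Real.log y - Real.log (1 - y)) y := by
  have hs := (hasDerivAt_id y).const_sub 1
  have h := ((hasDerivAt_id y).mul (Real.hasDerivAt_log h0)).add (hs.mul (hs.log h1))
  refine h.congr_deriv ?_
  simp only [id]
  field_simp
  ring

/-- The derivative is `(1 - 2y)² / (y(1 - y))`, which vanishes only at `1/2`; strict monotonicity on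
the two halves is glued there. -/
theorem strictMonoOn_logit_sub :
    StrictMonoOn (fun t : ℝ => Real.log t - Real.log (1 - t) - 4 * t) (Ioo 0 1) := by
  have hd : ∀ y ∈ Ioo (0 : ℝ) 1, HasDerivAt
      (fun t : ℝ => Real.log t - Real.log (1 - t) - 4 * t) (1 / y + 1 / (1 - y) - 4) y := by
    intro y hy
    have := (hasDerivAt_logit hy.1.ne' (sub_pos.2 hy.2).ne').sub
      ((hasDerivAt_id y).const_mul 4)
    exact this.congr_deriv (by simp)
  have hpos : ∀ y ∈ Ioo (0 : ℝ) 1, y ≠ 1 / 2 → 0 < 1 / y + 1 / (1 - y) - 4 := by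
    intro y hy hne
    have h0 := hy.1
    have h1 := sub_pos.2 hy.2
    have : 1 / y + 1 / (1 - y) - 4 = (1 - 2 * y) ^ 2 / (y * (1 - y)) := by
      field_simp
      ring
    rw [this]
    have h2 : (1 - 2 * y) ≠ 0 := fun h => hne (by linarith)
    positivity
  have hc : ContinuousOn (fun t : ℝ => Real.log t - Real.log (1 - t) - 4 * t) (Ioo 0 1) :=
    fun y hy => (hd y hy).continuousAt.continuousWithinAt
  have hl : StrictMonoOn (fun t : ℝ => Real.log t - Real.log (1 - t) - 4 * t)
      (Ioc 0 (1 / 2)) := by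
    refine strictMonoOn_of_deriv_pos (convex_Ioc _ _)
      (hc.mono fun y hy => ⟨hy.1, by linarith [hy.2]⟩) fun y hy => ?_
    rw [interior_Ioc] at hy
    have hy' : y ∈ Ioo (0 : ℝ) 1 := ⟨hy.1, by linarith [hy.2]⟩
    rw [(hd y hy').deriv]
    exact hpos y hy' hy.2.ne
  have hr : StrictMonoOn (fun t : ℝ => Real.log t - Real.log (1 - t) - 4 * t)
      (Ico (1 / 2) 1) := by
    refine strictMonoOn_of_deriv_pos (convex_Ico _ _)
      (hc.mono fun y hy => ⟨by linarith [hy.1], hy.2⟩) fun y hy => ?_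
    rw [interior_Ico] at hy
    have hy' : y ∈ Ioo (0 : ℝ) 1 := ⟨by linarith [hy.1], hy.2⟩
    rw [(hd y hy').deriv]
    exact hpos y hy' hy.1.ne'
  have h := hl.union hr (c := 1 / 2) ⟨⟨by norm_num, le_rfl⟩, fun y hy => hy.2⟩
    ⟨⟨le_rfl, by norm_num⟩, fun y hy => hy.1⟩
  rwa [Ioc_union_Ico_eq_Ioo (by norm_num) (by norm_num)] at h

/-- The binary negative entropy is strictly `4`-strongly convex. -/
theorem negEntropy_tangent_lt {x y : ℝ} (hx : x ∈ Ioo (0 : ℝ) 1) (hy : y ∈ Ioo (0 : ℝ) 1)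
    (hne : y ≠ x) :
    x * Real.log x + (1 - x) * Real.log (1 - x)
      + (Real.log x - Real.log (1 - x)) * (y - x) + 2 * (y - x) ^ 2
      < y * Real.log y + (1 - y) * Real.log (1 - y) := by
  -- `k` is still strictly convex, and its tangent inequality is the claim because `2y² - 2x² - 4x(y
  -- - x) = 2(y - x)²`.
  set k : ℝ → ℝ := fun t => (t * Real.log t + (1 - t) * Real.log (1 - t)) - 2 * t ^ 2 with hk
  have hd : ∀ t ∈ Ioo (0 : ℝ) 1,
      HasDerivAt k (Real.log t - Real.log (1 - t) - 4 * t) t := by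
    intro t ht
    have := (hasDerivAt_negEntropy ht.1.ne' (sub_pos.2 ht.2).ne').sub
      ((hasDerivAt_pow 2 t).const_mul 2)
    refine this.congr_deriv ?_
    simp
    ring
  have hconv : StrictConvexOn ℝ (Ioo (0 : ℝ) 1) k := by
    refine StrictMonoOn.strictConvexOn_of_deriv (convex_Ioo _ _)
      (fun t ht => (hd t ht).continuousAt.continuousWithinAt) ?_
    rw [interior_Ioo]
    exact strictMonoOn_logit_sub.congr fun t ht => (hd t ht).deriv.symm
  have key : k x + (Real.log x - Real.log (1 - x) - 4 * x) * (y - x) < k y := by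
    rcases lt_or_gt_of_ne hne with h | h
    · have h1 := hconv.slope_lt_of_hasDerivAt hy hx h (hd x hx)
      rw [slope_def_field, div_lt_iff₀ (by linarith)] at h1
      linarith
    · have h1 := hconv.lt_slope_of_hasDerivAt hx hy h (hd x hx)
      rw [slope_def_field, lt_div_iff₀ (by linarith)] at h1
      linarith
  simp only [hk] at key
  nlinarith [key]

/-! ### Gradient and strong convexity of the dual objective -/

theorem inner_eq_sum {n : ℕ} (u v : EuclideanSpace ℝ (Fin n)) :
    inner ℝ u v = ∑ i, u i * v i := by
  simp [PiLp.inner_apply, mul_comm]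

theorem norm_sq_eq_sum {n : ℕ} (u : EuclideanSpace ℝ (Fin n)) : ‖u‖ ^ 2 = ∑ i, u i ^ 2 := by
  rw [← real_inner_self_eq_norm_sq, inner_eq_sum]
  simp [sq]

theorem hasFDerivAt_dualObj {θ : EuclideanSpace ℝ (Fin m)} (hθ : ∀ i, θ i ∈ Ioo (0 : ℝ) 1) :
    HasFDerivAt dualObj ((1 / (m : ℝ)) • ∑ i, (Real.log (θ i) - Real.log (1 - θ i)) •
      (EuclideanSpace.proj i : EuclideanSpace ℝ (Fin m) →L[ℝ] ℝ)) θ := by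
  unfold dualObj
  refine HasFDerivAt.const_mul (HasFDerivAt.fun_sum fun i _ => ?_) _
  exact (hasDerivAt_negEntropy (hθ i).1.ne' (sub_pos.2 (hθ i).2).ne').comp_hasFDerivAt θ
    (EuclideanSpace.proj i : EuclideanSpace ℝ (Fin m) →L[ℝ] ℝ).hasFDerivAt

theorem inner_gradient_dualObj {θ : EuclideanSpace ℝ (Fin m)}
    (hθ : ∀ i, θ i ∈ Ioo (0 : ℝ) 1) (v : EuclideanSpace ℝ (Fin m)) :
    inner ℝ (∇ dualObj θ) v
      = 1 / (m : ℝ) * ∑ i, (Real.log (θ i) - Real.log (1 - θ i)) * v i := by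
  rw [gradient, InnerProductSpace.toDual_symm_apply, (hasFDerivAt_dualObj hθ).fderiv]
  simp

/-- Strict strong convexity of the dual objective. -/
theorem dualObj_tangent_lt {θ θ' : EuclideanSpace ℝ (Fin m)} (hθ : ∀ i, θ i ∈ Ioo (0 : ℝ) 1)
    (hθ' : ∀ i, θ' i ∈ Ioo (0 : ℝ) 1) (hne : θ' ≠ θ) :
    dualObj θ + inner ℝ (∇ dualObj θ) (θ' - θ) + 2 / m * ‖θ' - θ‖ ^ 2 < dualObj θ' := by
  have hex : ∃ i, θ' i ≠ θ i := by
    by_contra! h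
    exact hne (PiLp.ext h)
  obtain ⟨i₀, hi₀⟩ := hex
  have hm : 0 < (m : ℝ) := Nat.cast_pos.2 (Fin.pos i₀)
  rw [inner_gradient_dualObj hθ, norm_sq_eq_sum]
  have : (2 : ℝ) / m * ∑ i, (θ' - θ) i ^ 2 = 1 / m * ∑ i, 2 * (θ' - θ) i ^ 2 := by
    rw [← Finset.mul_sum]; ring
  rw [this]
  unfold dualObj
  rw [← mul_add, ← mul_add, ← Finset.sum_add_distrib, ← Finset.sum_add_distrib]
  refine mul_lt_mul_of_pos_left ?_ (by positivity)
  refine Finset.sum_lt_sum (fun i _ => ?_) ⟨i₀, Finset.mem_univ _, ?_⟩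
  · by_cases h : θ' i = θ i
    · simp [h]
    · exact (negEntropy_tangent_lt (hθ i) (hθ' i) h).le
  · exact negEntropy_tangent_lt (hθ i₀) (hθ' i₀) hi₀

theorem dualObj_tangent_le {θ θ' : EuclideanSpace ℝ (Fin m)} (hθ : ∀ i, θ i ∈ Ioo (0 : ℝ) 1)
    (hθ' : ∀ i, θ' i ∈ Ioo (0 : ℝ) 1) :
    dualObj θ + inner ℝ (∇ dualObj θ) (θ' - θ) + 2 / m * ‖θ' - θ‖ ^ 2 ≤ dualObj θ' := by
  by_cases h : θ' = θ
  · simp [h]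
  · exact (dualObj_tangent_lt hθ hθ' h).le

/-! ### First-order conditions of the primal problem -/

/-- The derivative at a right-sided local minimum is nonnegative. -/
theorem HasDerivAt.nonneg_of_eventually_le {f : ℝ → ℝ} {f' a : ℝ} (hf : HasDerivAt f f' a)
    (h : ∀ᶠ t in 𝓝[>] a, f a ≤ f t) : 0 ≤ f' := by
  have ht := hf.hasDerivWithinAt (s := Ioi a)
  rw [hasDerivWithinAt_iff_tendsto_slope' (by simp)] at ht
  refine ge_of_tendsto ht ?_
  filter_upwards [h, self_mem_nhdsWithin] with t h1 h2
  rw [slope_def_field]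
  exact div_nonneg (by linarith) (by linarith [mem_Ioi.1 h2])

theorem hasDerivAt_logLoss (z v : ℝ) :
    HasDerivAt (fun t : ℝ => Real.log (1 + Real.exp (-(z + t * v))))
      (-(v * (1 / (1 + Real.exp z)))) 0 := by
  have h1 : HasDerivAt (fun t : ℝ => -(z + t * v)) (-v) 0 := by
    exact (((hasDerivAt_id (0 : ℝ)).mul_const v).const_add z).neg.congr_deriv (by simp)
  have h2 := (h1.exp.const_add 1).log (by positivity)
  convert h2 using 1
  have : Real.exp (-z) = 1 / Real.exp z := by rw [Real.exp_neg, one_div]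
  simp [this]
  have := Real.exp_pos z
  field_simp
  ring

/-- The margins of a primal point. -/
def margin (x : Fin m → EuclideanSpace ℝ (Fin p)) (b : EuclideanSpace ℝ (Fin m))
    (β : EuclideanSpace ℝ (Fin p)) (c : ℝ) (i : Fin m) : ℝ :=
  inner ℝ β (xbarRow x b i) + b i * c

/-- The dual point associated with a primal point. -/
def dualPoint (x : Fin m → EuclideanSpace ℝ (Fin p)) (b : EuclideanSpace ℝ (Fin m))
    (β : EuclideanSpace ℝ (Fin p)) (c : ℝ) : EuclideanSpace ℝ (Fin m) :=
  WithLp.toLp 2 fun i => 1 / (1 + Real.exp (margin x b β c i))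

theorem dualPoint_mem_Ioo (x : Fin m → EuclideanSpace ℝ (Fin p)) (b : EuclideanSpace ℝ (Fin m))
    (β : EuclideanSpace ℝ (Fin p)) (c : ℝ) (i : Fin m) :
    dualPoint x b β c i ∈ Ioo (0 : ℝ) 1 := by
  have := Real.exp_pos (margin x b β c i)
  refine ⟨by simp only [dualPoint]; positivity, ?_⟩
  simp only [dualPoint]
  rw [div_lt_one (by positivity)]
  linarith

/-- Thus the dual gradient at `dualPoint` is minus the margins divided by `m`, which turns primal
stationarity into dual optimality. -/
theorem logit_dualPoint (x : Fin m → EuclideanSpace ℝ (Fin p)) (b : EuclideanSpace ℝ (Fin m))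
    (β : EuclideanSpace ℝ (Fin p)) (c : ℝ) (i : Fin m) :
    Real.log (dualPoint x b β c i) - Real.log (1 - dualPoint x b β c i)
      = -margin x b β c i := by
  have h := dualPoint_mem_Ioo x b β c i
  rw [← Real.log_div h.1.ne' (sub_pos.2 h.2).ne']
  simp only [dualPoint]
  have := Real.exp_pos (margin x b β c i)
  rw [show 1 / (1 + Real.exp (margin x b β c i)) / (1 - 1 / (1 + Real.exp (margin x b β c i)))
    = Real.exp (-margin x b β c i) by rw [Real.exp_neg]; field_simp; ring, Real.log_exp]

theorem sum_mul_inner_xbarRow (x : Fin m → EuclideanSpace ℝ (Fin p))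
    (b θ : EuclideanSpace ℝ (Fin m)) (β : EuclideanSpace ℝ (Fin p)) :
    ∑ i, inner ℝ β (xbarRow x b i) * θ i = ∑ j, β j * inner ℝ θ (xbarCol x b j) := by
  simp only [inner_eq_sum, Finset.sum_mul, Finset.mul_sum]
  rw [Finset.sum_comm]
  refine Finset.sum_congr rfl fun j _ => Finset.sum_congr rfl fun i _ => ?_
  simp only [xbarCol]
  ring

/-- The variational inequality at a primal minimizer. -/
theorem IsPrimalOptimal.variational {x : Fin m → EuclideanSpace ℝ (Fin p)}
    {b : EuclideanSpace ℝ (Fin m)} {lam : ℝ} (hlam : 0 < lam) {β : EuclideanSpace ℝ (Fin p)}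
    {c : ℝ} (h : IsPrimalOptimal x b lam β c) (v : EuclideanSpace ℝ (Fin p)) (s : ℝ) :
    1 / (m : ℝ) * (∑ j, v j * inner ℝ (dualPoint x b β c) (xbarCol x b j)
      + s * inner ℝ (dualPoint x b β c) b) ≤ lam * ∑ j, (|β j + v j| - |β j|) := by
  -- The `ℓ₁` term is replaced by its chord from `β` to `β + v`. By convexity the chord lies above
  -- it on `[0, 1]` and agrees at `0`, so `L`, unlike the objective, is differentiable and still has
  -- a right-sided minimum at `0`.
  set L : ℝ → ℝ := fun t => 1 / (m : ℝ) * ∑ i, Real.log (1 + Real.exp (-(margin x b β c i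
    + t * (inner ℝ v (xbarRow x b i) + b i * s)))) + lam * (t * ∑ j, (|β j + v j| - |β j|))
    with hL
  have hd : HasDerivAt L (1 / (m : ℝ) * ∑ i, -((inner ℝ v (xbarRow x b i) + b i * s) *
      (1 / (1 + Real.exp (margin x b β c i)))) + lam * ∑ j, (|β j + v j| - |β j|)) 0 := by
    refine ((HasDerivAt.fun_sum fun i _ => hasDerivAt_logLoss _ _).const_mul _).add ?_
    simpa using ((hasDerivAt_id (0 : ℝ)).mul_const (∑ j, (|β j + v j| - |β j|))).const_mul lam
  have hmin : ∀ᶠ t in 𝓝[>] (0 : ℝ), L 0 ≤ L t := by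
    filter_upwards [Ioo_mem_nhdsGT (zero_lt_one' ℝ)] with t ht
    have h1 := h (β + t • v) (c + t * s)
    unfold primalObj at h1
    have h2 : ∑ j, |(β + t • v) j| ≤ ∑ j, |β j| + t * ∑ j, (|β j + v j| - |β j|) := by
      rw [Finset.mul_sum, ← Finset.sum_add_distrib]
      refine Finset.sum_le_sum fun j _ => ?_
      have : (β + t • v) j = (1 - t) * β j + t * (β j + v j) := by simp; ring
      rw [this]
      refine (abs_add_le _ _).trans (le_of_eq ?_)
      rw [abs_mul, abs_mul, abs_of_pos ht.1, abs_of_pos (sub_pos.2 ht.2)]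
      ring
    have h3 := mul_le_mul_of_nonneg_left h2 hlam.le
    have e1 : ∀ i, -(inner ℝ (β + t • v) (xbarRow x b i)) - b i * (c + t * s)
        = -(margin x b β c i + t * (inner ℝ v (xbarRow x b i) + b i * s)) := by
      intro i
      rw [inner_add_left, real_inner_smul_left, margin]
      ring
    have e2 : ∀ i, -(inner ℝ β (xbarRow x b i)) - b i * c = -margin x b β c i := by
      intro i
      rw [margin]
      ring
    simp only [e1, e2] at h1
    simp only [hL, zero_mul, add_zero, mul_zero]
    rw [mul_add] at h3
    linarith
  have h0 := HasDerivAt.nonneg_of_eventually_le hd hmin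
  have e : ∑ i, -((inner ℝ v (xbarRow x b i) + b i * s) *
      (1 / (1 + Real.exp (margin x b β c i))))
      = -(∑ j, v j * inner ℝ (dualPoint x b β c) (xbarCol x b j)
      + s * inner ℝ (dualPoint x b β c) b) := by
    rw [← sum_mul_inner_xbarRow, inner_eq_sum, Finset.mul_sum, ← Finset.sum_add_distrib,
      ← Finset.sum_neg_distrib]
    refine Finset.sum_congr rfl fun i _ => ?_
    simp only [dualPoint]
    ring
  rw [e] at h0
  linarith

theorem IsPrimalOptimal.inner_label {x : Fin m → EuclideanSpace ℝ (Fin p)}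
    {b : EuclideanSpace ℝ (Fin m)} {lam : ℝ} (hlam : 0 < lam) (hm : 0 < m)
    {β : EuclideanSpace ℝ (Fin p)} {c : ℝ} (h : IsPrimalOptimal x b lam β c) :
    inner ℝ (dualPoint x b β c) b = 0 := by
  have hm' : 0 < (m : ℝ) := Nat.cast_pos.2 hm
  have h1 := h.variational hlam 0 1
  have h2 := h.variational hlam 0 (-1)
  simp only [PiLp.zero_apply, zero_mul, Finset.sum_const_zero, zero_add, add_zero, sub_self,
    mul_zero, one_div, inv_mul_le_iff₀ hm'] at h1 h2
  linarith

/-- Steps `s = ±1` will give dual feasibility, and `s = ±β j` complementarity. -/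
theorem IsPrimalOptimal.coord {x : Fin m → EuclideanSpace ℝ (Fin p)}
    {b : EuclideanSpace ℝ (Fin m)} {lam : ℝ} (hlam : 0 < lam) (hm : 0 < m)
    {β : EuclideanSpace ℝ (Fin p)} {c : ℝ} (h : IsPrimalOptimal x b lam β c) (j : Fin p)
    (s : ℝ) :
    s * inner ℝ (dualPoint x b β c) (xbarCol x b j) ≤ m * lam * (|β j + s| - |β j|) := by
  have hm' : 0 < (m : ℝ) := Nat.cast_pos.2 hm
  have h1 := h.variational hlam (EuclideanSpace.single j s) 0
  have e1 : ∑ k, (EuclideanSpace.single j s : EuclideanSpace ℝ (Fin p)) k *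
      inner ℝ (dualPoint x b β c) (xbarCol x b k)
      = s * inner ℝ (dualPoint x b β c) (xbarCol x b j) := by
    rw [Finset.sum_eq_single j]
    · simp
    · intro k _ hk
      simp [hk]
    · simp
  have e2 : ∑ k, (|β k + (EuclideanSpace.single j s : EuclideanSpace ℝ (Fin p)) k| - |β k|)
      = |β j + s| - |β j| := by
    rw [Finset.sum_eq_single j]
    · simp
    · intro k _ hk
      simp [hk]
    · simp
  rw [e1, e2, zero_mul, add_zero, one_div, inv_mul_le_iff₀ hm'] at h1
  linarith

theorem IsPrimalOptimal.abs_inner_le {x : Fin m → EuclideanSpace ℝ (Fin p)}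
    {b : EuclideanSpace ℝ (Fin m)} {lam : ℝ} (hlam : 0 < lam) (hm : 0 < m)
    {β : EuclideanSpace ℝ (Fin p)} {c : ℝ} (h : IsPrimalOptimal x b lam β c) (j : Fin p) :
    |inner ℝ (dualPoint x b β c) (xbarCol x b j)| ≤ m * lam := by
  have hml : 0 ≤ m * lam := by positivity
  have h1 := h.coord hlam hm j 1
  have h2 := h.coord hlam hm j (-1)
  have h3 : |β j + 1| - |β j| ≤ 1 := by
    have := abs_add_le (β j) 1
    rw [abs_one] at this
    linarith
  have h4 : |β j + -1| - |β j| ≤ 1 := by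
    have := abs_add_le (β j) (-1)
    rw [abs_neg, abs_one] at this
    linarith
  rw [abs_le]
  constructor <;> nlinarith

theorem IsPrimalOptimal.mul_inner_eq {x : Fin m → EuclideanSpace ℝ (Fin p)}
    {b : EuclideanSpace ℝ (Fin m)} {lam : ℝ} (hlam : 0 < lam) (hm : 0 < m)
    {β : EuclideanSpace ℝ (Fin p)} {c : ℝ} (h : IsPrimalOptimal x b lam β c) (j : Fin p) :
    β j * inner ℝ (dualPoint x b β c) (xbarCol x b j) = m * lam * |β j| := by
  have h1 := h.coord hlam hm j (-β j)
  rw [add_neg_cancel, abs_zero] at h1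
  have h2 := h.coord hlam hm j (β j)
  have : |β j + β j| = 2 * |β j| := by rw [← two_mul, abs_mul, abs_two]
  rw [this] at h2
  linarith

/-- Complementary slackness: inactive features have zero coefficient. -/
theorem IsPrimalOptimal.coeff_eq_zero {x : Fin m → EuclideanSpace ℝ (Fin p)}
    {b : EuclideanSpace ℝ (Fin m)} {lam : ℝ} (hlam : 0 < lam) (hm : 0 < m)
    {β : EuclideanSpace ℝ (Fin p)} {c : ℝ} (h : IsPrimalOptimal x b lam β c) {j : Fin p}
    (hj : |inner ℝ (dualPoint x b β c) (xbarCol x b j)| < m * lam) : β j = 0 := by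
  by_contra hne
  have h1 := h.mul_inner_eq hlam hm j
  have h2 := le_abs_self (β j * inner ℝ (dualPoint x b β c) (xbarCol x b j))
  rw [abs_mul] at h2
  have h3 := abs_pos.2 hne
  nlinarith

/-! ### Dual feasibility and dual optimality -/

theorem corrNorm_le_iff {x : Fin m → EuclideanSpace ℝ (Fin p)} {b θ : EuclideanSpace ℝ (Fin m)}
    {r : ℝ} (hr : 0 ≤ r) :
    corrNorm x b θ ≤ r ↔ ∀ j, |inner ℝ θ (xbarCol x b j)| ≤ r := by
  simp [corrNorm, pi_norm_le_iff_of_nonneg hr]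

theorem IsPrimalOptimal.dualPoint_mem {x : Fin m → EuclideanSpace ℝ (Fin p)}
    {b : EuclideanSpace ℝ (Fin m)} {lam : ℝ} (hlam : 0 < lam) (hm : 0 < m)
    {β : EuclideanSpace ℝ (Fin p)} {c : ℝ} (h : IsPrimalOptimal x b lam β c) :
    dualPoint x b β c ∈ dualFeasible x b lam :=
  ⟨(corrNorm_le_iff (by positivity)).2 (h.abs_inner_le hlam hm), h.inner_label hlam hm,
    dualPoint_mem_Ioo x b β c⟩

/-- The dual point of a primal minimizer solves the dual problem. -/
theorem IsPrimalOptimal.dualObj_le {x : Fin m → EuclideanSpace ℝ (Fin p)}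
    {b : EuclideanSpace ℝ (Fin m)} {lam : ℝ} (hlam : 0 < lam) (hm : 0 < m)
    {β : EuclideanSpace ℝ (Fin p)} {c : ℝ} (h : IsPrimalOptimal x b lam β c)
    {θ : EuclideanSpace ℝ (Fin m)} (hθ : θ ∈ dualFeasible x b lam) :
    dualObj (dualPoint x b β c) + 2 / m * ‖θ - dualPoint x b β c‖ ^ 2 ≤ dualObj θ := by
  have hm' : 0 < (m : ℝ) := Nat.cast_pos.2 hm
  have h1 := dualObj_tangent_le (dualPoint_mem_Ioo x b β c) hθ.2.2
  suffices 0 ≤ inner ℝ (∇ dualObj (dualPoint x b β c)) (θ - dualPoint x b β c) by linarith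
  rw [inner_gradient_dualObj (dualPoint_mem_Ioo x b β c)]
  refine mul_nonneg (by positivity) ?_
  simp only [logit_dualPoint]
  have e : ∀ θ' : EuclideanSpace ℝ (Fin m), inner ℝ θ' b = 0 →
      ∑ i, margin x b β c i * θ' i = ∑ j, β j * inner ℝ θ' (xbarCol x b j) := by
    intro θ' hθ'
    rw [← sum_mul_inner_xbarRow]
    rw [inner_eq_sum] at hθ'
    have : ∑ i, margin x b β c i * θ' i
        = ∑ i, inner ℝ β (xbarRow x b i) * θ' i + c * ∑ i, θ' i * b i := by
      rw [Finset.mul_sum, ← Finset.sum_add_distrib]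
      refine Finset.sum_congr rfl fun i _ => ?_
      rw [margin]
      ring
    rw [this, hθ', mul_zero, add_zero]
  -- Hölder: for feasible `θ` the left side is at most `m * lam * ‖β‖₁`, and complementarity gives
  -- equality at the dual point. The intercept has dropped out by orthogonality to `b`.
  have hle : ∑ j, β j * inner ℝ θ (xbarCol x b j)
      ≤ ∑ j, β j * inner ℝ (dualPoint x b β c) (xbarCol x b j) := by
    refine Finset.sum_le_sum fun j _ => ?_
    rw [h.mul_inner_eq hlam hm j]
    refine (le_abs_self _).trans ?_
    rw [abs_mul, mul_comm]
    exact mul_le_mul_of_nonneg_right ((corrNorm_le_iff (by positivity)).1 hθ.1 j) (abs_nonneg _)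
  rw [← e θ hθ.2.1, ← e _ (h.inner_label hlam hm)] at hle
  have : ∑ i, -margin x b β c i * (θ - dualPoint x b β c) i
      = ∑ i, margin x b β c i * dualPoint x b β c i - ∑ i, margin x b β c i * θ i := by
    rw [← Finset.sum_sub_distrib]
    refine Finset.sum_congr rfl fun i _ => ?_
    simp only [PiLp.sub_apply]
    ring
  rw [this]
  linarith

/-- The gradient of the dual objective is nonnegative along directions in which a minimizer can be
moved without violating the correlation and label constraints. -/
theorem IsDualOptimal.gradient_nonneg {x : Fin m → EuclideanSpace ℝ (Fin p)}
    {b : EuclideanSpace ℝ (Fin m)} {lam : ℝ} {θ₀ : EuclideanSpace ℝ (Fin m)}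
    (h : IsDualOptimal x b lam θ₀) {v : EuclideanSpace ℝ (Fin m)} (hv : inner ℝ v b = 0)
    (hc : ∀ᶠ t in 𝓝[>] (0 : ℝ), corrNorm x b (θ₀ + t • v) ≤ m * lam) :
    0 ≤ inner ℝ (∇ dualObj θ₀) v := by
  have hg : HasGradientAt dualObj (∇ dualObj θ₀) θ₀ :=
    (hasFDerivAt_dualObj h.1.2.2).differentiableAt.hasGradientAt
  have hd : HasDerivAt (fun t : ℝ => dualObj (θ₀ + t • v)) (inner ℝ (∇ dualObj θ₀) v) 0 := by
    have := hg.hasFDerivAt.hasLineDerivAt v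
    simpa [HasLineDerivAt] using this
  -- The box is open, so it restricts no direction; `θ₀ + v` itself may lie outside it.
  have hbox : ∀ᶠ t in 𝓝[>] (0 : ℝ), ∀ i, (θ₀ + t • v) i ∈ Ioo (0 : ℝ) 1 := by
    refine nhdsWithin_le_nhds (eventually_all.2 fun i => ?_)
    have hci : Continuous fun t : ℝ => (θ₀ + t • v) i := by fun_prop
    exact hci.continuousAt.eventually_mem
      (isOpen_Ioo.mem_nhds (by simpa using h.1.2.2 i))
  refine HasDerivAt.nonneg_of_eventually_le hd ?_
  filter_upwards [hc, hbox] with t h1 h2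
  have h3 := isMinOn_iff.1 h.2 (θ₀ + t • v) ⟨h1, by
    rw [inner_add_left, real_inner_smul_left, hv, h.1.2.1]; simp, h2⟩
  simpa using h3

/-! ### The point `thetaMax` and the threshold `lambdaMax` -/

theorem mPlus_add_mMinus {b : EuclideanSpace ℝ (Fin m)} (hb : ∀ i, b i = 1 ∨ b i = -1) :
    mPlus b + mMinus b = m := by
  classical
  have : (Finset.univ.filter fun i => b i = -1) = Finset.univ.filter fun i => ¬ b i = 1 := by
    refine Finset.filter_congr fun i _ => ?_
    rcases hb i with h | h <;> rw [h] <;> norm_num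
  unfold mPlus mMinus
  rw [this, Finset.card_filter_add_card_filter_not]
  simp

theorem exists_label_one {b θ : EuclideanSpace ℝ (Fin m)} (hb : ∀ i, b i = 1 ∨ b i = -1)
    (hm : 0 < m) (hθ : ∀ i, 0 < θ i) (hθb : inner ℝ θ b = 0) : ∃ i, b i = 1 := by
  by_contra! hne
  have hb' : ∀ i, b i = -1 := fun i => (hb i).resolve_left (hne i)
  rw [inner_eq_sum] at hθb
  simp only [hb', mul_neg, mul_one, Finset.sum_neg_distrib, neg_eq_zero] at hθb
  have : 0 < ∑ i, θ i := Finset.sum_pos (fun i _ => hθ i) ⟨⟨0, hm⟩, Finset.mem_univ _⟩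
  linarith

theorem exists_label_neg_one {b θ : EuclideanSpace ℝ (Fin m)} (hb : ∀ i, b i = 1 ∨ b i = -1)
    (hm : 0 < m) (hθ : ∀ i, 0 < θ i) (hθb : inner ℝ θ b = 0) : ∃ i, b i = -1 := by
  obtain ⟨i, hi⟩ := exists_label_one (b := -b) (θ := θ)
    (fun i => by rcases hb i with h | h <;> simp [h]) hm hθ (by simp [hθb])
  exact ⟨i, by simpa [neg_eq_iff_eq_neg] using hi⟩

/-- A positive `θ` orthogonal to `b` certifies that both labels occur; with a single label `thetaMax
b` would be zero. -/
theorem thetaMax_mem_Ioo {b θ : EuclideanSpace ℝ (Fin m)} (hb : ∀ i, b i = 1 ∨ b i = -1)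
    (hm : 0 < m) (hθ : ∀ i, 0 < θ i) (hθb : inner ℝ θ b = 0) (i : Fin m) :
    thetaMax b i ∈ Ioo (0 : ℝ) 1 := by
  have hm' : 0 < (m : ℝ) := Nat.cast_pos.2 hm
  obtain ⟨i₁, h₁⟩ := exists_label_one hb hm hθ hθb
  obtain ⟨i₂, h₂⟩ := exists_label_neg_one hb hm hθ hθb
  have hp : 0 < mPlus b := Finset.card_pos.2 ⟨i₁, by simp [h₁]⟩
  have hn : 0 < mMinus b := Finset.card_pos.2 ⟨i₂, by simp [h₂]⟩
  have hs : (mPlus b : ℝ) + mMinus b = m := by exact_mod_cast mPlus_add_mMinus hb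
  have hp' : 0 < (mPlus b : ℝ) := Nat.cast_pos.2 hp
  have hn' : 0 < (mMinus b : ℝ) := Nat.cast_pos.2 hn
  simp only [thetaMax]
  split_ifs
  · exact ⟨by positivity, by rw [div_lt_one hm']; linarith⟩
  · exact ⟨by positivity, by rw [div_lt_one hm']; linarith⟩

theorem thetaMax_inner {b : EuclideanSpace ℝ (Fin m)} (hb : ∀ i, b i = 1 ∨ b i = -1) :
    inner ℝ (thetaMax b) b = 0 := by
  have : ∀ i, thetaMax b i * b i
      = (if b i = 1 then (mMinus b : ℝ) / m else 0) + if b i = -1 then -((mPlus b : ℝ) / m) else 0 := by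
    intro i
    simp only [thetaMax]
    rcases hb i with h | h <;> rw [h] <;> norm_num
  rw [inner_eq_sum, Finset.sum_congr rfl fun i _ => this i, Finset.sum_add_distrib,
    ← Finset.sum_filter, ← Finset.sum_filter, Finset.sum_const, Finset.sum_const]
  change mPlus b • _ + mMinus b • _ = (0 : ℝ)
  simp only [nsmul_eq_mul]
  ring

/-- The gradient of the dual objective at `thetaMax` is a multiple of the label vector. -/
theorem logit_thetaMax {b : EuclideanSpace ℝ (Fin m)} (hb : ∀ i, b i = 1 ∨ b i = -1)
    (hm : 0 < m) :
    ∃ k : ℝ, ∀ i, Real.log (thetaMax b i) - Real.log (1 - thetaMax b i) = k * b i := by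
  have hm' : (m : ℝ) ≠ 0 := (Nat.cast_pos.2 hm).ne'
  have hs : (mPlus b : ℝ) + mMinus b = m := by exact_mod_cast mPlus_add_mMinus hb
  have e1 : 1 - (mMinus b : ℝ) / m = mPlus b / m := by field_simp; linarith
  have e2 : 1 - (mPlus b : ℝ) / m = mMinus b / m := by field_simp; linarith
  refine ⟨Real.log (mMinus b / m) - Real.log (mPlus b / m), fun i => ?_⟩
  simp only [thetaMax]
  rcases hb i with h | h
  · rw [if_pos h, e1, h, mul_one]
  · rw [if_neg (by rw [h]; norm_num), e2, h]
    ring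

/-- `thetaMax` is the strong minimizer of the dual objective on the label hyperplane. -/
theorem dualObj_thetaMax_le {b θ : EuclideanSpace ℝ (Fin m)} (hb : ∀ i, b i = 1 ∨ b i = -1)
    (hm : 0 < m) (hθ : ∀ i, θ i ∈ Ioo (0 : ℝ) 1) (hθb : inner ℝ θ b = 0) :
    dualObj (thetaMax b) + 2 / m * ‖θ - thetaMax b‖ ^ 2 ≤ dualObj θ := by
  have hbox := thetaMax_mem_Ioo hb hm (fun i => (hθ i).1) hθb
  have h := dualObj_tangent_le hbox hθ
  obtain ⟨k, hk⟩ := logit_thetaMax hb hm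
  have : inner ℝ (∇ dualObj (thetaMax b)) (θ - thetaMax b) = 0 := by
    rw [inner_gradient_dualObj hbox]
    simp only [hk]
    have : ∑ i, k * b i * (θ - thetaMax b) i = k * inner ℝ (θ - thetaMax b) b := by
      rw [inner_eq_sum, Finset.mul_sum]
      exact Finset.sum_congr rfl fun i _ => by ring
    rw [this, inner_sub_left, hθb, thetaMax_inner hb]
    simp
  linarith

theorem corrNorm_thetaMax (x : Fin m → EuclideanSpace ℝ (Fin p)) (b : EuclideanSpace ℝ (Fin m))
    (hm : 0 < m) : corrNorm x b (thetaMax b) = m * lambdaMax x b := by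
  have hm' : (m : ℝ) ≠ 0 := (Nat.cast_pos.2 hm).ne'
  unfold lambdaMax
  field_simp

theorem eq_of_two_div_mul_norm_sq_le {θ θ' : EuclideanSpace ℝ (Fin m)} {s t : ℝ} (hm : 0 < m)
    (h1 : s + 2 / m * ‖θ - θ'‖ ^ 2 ≤ t) (h2 : t ≤ s) : θ = θ' := by
  have hm' : 0 < (m : ℝ) := Nat.cast_pos.2 hm
  have h3 : 2 / m * ‖θ - θ'‖ ^ 2 ≤ 0 := by linarith
  have h4 : ‖θ - θ'‖ ^ 2 ≤ 0 := nonpos_of_mul_nonpos_right h3 (by positivity)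
  have h5 : ‖θ - θ'‖ = 0 := by
    nlinarith [norm_nonneg (θ - θ')]
  exact sub_eq_zero.1 (norm_eq_zero.1 h5)

/-- Since `thetaMax` is feasible, uniqueness identifies it with the dual point. Its logits are
multiples of `b i`, hence so are the numbers `⟨β, x̄ᵢ⟩`, and `m * lam * ‖β‖₁ = ∑ᵢ ⟨β, x̄ᵢ⟩ θᵢ` is a
multiple of `⟨θ, b⟩ = 0`. -/
theorem IsPrimalOptimal.eq_zero_of_lambdaMax_le {x : Fin m → EuclideanSpace ℝ (Fin p)}
    {b : EuclideanSpace ℝ (Fin m)} (hb : ∀ i, b i = 1 ∨ b i = -1) {lam : ℝ} (hlam : 0 < lam)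
    (hle : lambdaMax x b ≤ lam) {β : EuclideanSpace ℝ (Fin p)} {c : ℝ}
    (h : IsPrimalOptimal x b lam β c) : β = 0 := by
  have hsum : ∑ j, |β j| ≤ 0 → β = 0 := by
    intro hs
    have h0 := (Finset.sum_eq_zero_iff_of_nonneg fun j _ => abs_nonneg (β j)).1
      (le_antisymm hs (Finset.sum_nonneg fun j _ => abs_nonneg (β j)))
    exact PiLp.ext fun j => abs_eq_zero.1 (h0 j (Finset.mem_univ j))
  apply hsum
  -- Without samples the objective is the penalty alone.
  rcases Nat.eq_zero_or_pos m with rfl | hm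
  · have := h 0 0
    simp only [primalObj, Finset.univ_eq_empty, Finset.sum_empty, mul_zero, zero_add,
      PiLp.zero_apply, abs_zero, Finset.sum_const_zero] at this
    exact nonpos_of_mul_nonpos_right this hlam
  have hm' : 0 < (m : ℝ) := Nat.cast_pos.2 hm
  have hfeas := h.dualPoint_mem hlam hm
  have hbox := thetaMax_mem_Ioo hb hm (fun i => (hfeas.2.2 i).1) hfeas.2.1
  have h1 := h.dualObj_le hlam hm (θ := thetaMax b) ⟨by
    rw [corrNorm_thetaMax x b hm]
    exact mul_le_mul_of_nonneg_left hle hm'.le, thetaMax_inner hb, hbox⟩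
  have h2 := dualObj_thetaMax_le hb hm hfeas.2.2 hfeas.2.1
  have heq : dualPoint x b β c = thetaMax b :=
    eq_of_two_div_mul_norm_sq_le hm h2 (le_trans (by
      have : 0 ≤ 2 / (m : ℝ) * ‖thetaMax b - dualPoint x b β c‖ ^ 2 := by positivity
      linarith) h1)
  obtain ⟨k, hk⟩ := logit_thetaMax hb hm
  have hz : ∀ i, inner ℝ β (xbarRow x b i) = (-k - c) * b i := by
    intro i
    have := hk i
    rw [← heq, logit_dualPoint, margin] at this
    linarith
  have e := sum_mul_inner_xbarRow x b (dualPoint x b β c) β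
  simp only [hz, h.mul_inner_eq hlam hm] at e
  have e2 : ∑ i, (-k - c) * b i * dualPoint x b β c i
      = (-k - c) * inner ℝ (dualPoint x b β c) b := by
    rw [inner_eq_sum, Finset.mul_sum]
    exact Finset.sum_congr rfl fun i _ => by ring
  rw [e2, hfeas.2.1, mul_zero, ← Finset.mul_sum] at e
  exact nonpos_of_mul_nonpos_right e.symm.le (by positivity)

theorem continuous_corrNorm (x : Fin m → EuclideanSpace ℝ (Fin p))
    (b : EuclideanSpace ℝ (Fin m)) : Continuous (corrNorm x b) := by
  unfold corrNorm
  fun_prop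

/-- If the constraint were slack, `θ₀` could move towards `thetaMax`; convexity would force `θ₀ =
thetaMax`, whose correlation norm `m * lambdaMax` is not below `m * lam₀`. -/
theorem IsDualOptimal.corrNorm_eq {x : Fin m → EuclideanSpace ℝ (Fin p)}
    {b : EuclideanSpace ℝ (Fin m)} (hb : ∀ i, b i = 1 ∨ b i = -1) (hm : 0 < m) {lam₀ : ℝ}
    (hle : lam₀ ≤ lambdaMax x b) {θ₀ : EuclideanSpace ℝ (Fin m)}
    (h : IsDualOptimal x b lam₀ θ₀) : corrNorm x b θ₀ = m * lam₀ := by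
  have hm' : 0 < (m : ℝ) := Nat.cast_pos.2 hm
  refine le_antisymm h.1.1 (not_lt.1 fun hlt => ?_)
  have hbox := thetaMax_mem_Ioo hb hm (fun i => (h.1.2.2 i).1) h.1.2.1
  have hgrad : 0 ≤ inner ℝ (∇ dualObj θ₀) (thetaMax b - θ₀) := by
    refine h.gradient_nonneg (by rw [inner_sub_left, thetaMax_inner hb, h.1.2.1, sub_zero]) ?_
    have hl : Continuous fun t : ℝ => θ₀ + t • (thetaMax b - θ₀) := by fun_prop
    have hc := ((continuous_corrNorm x b).comp hl).tendsto 0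
    refine nhdsWithin_le_nhds ?_
    have h1 := hc.eventually_lt_const (u := m * lam₀) (by
      simpa only [Function.comp_apply, zero_smul, add_zero] using hlt)
    exact h1.mono fun t ht => ht.le
  have h1 := dualObj_tangent_le h.1.2.2 hbox
  have h2 := dualObj_thetaMax_le hb hm h.1.2.2 h.1.2.1
  have heq : θ₀ = thetaMax b := eq_of_two_div_mul_norm_sq_le hm h2 (by
    have : 0 ≤ 2 / (m : ℝ) * ‖thetaMax b - θ₀‖ ^ 2 := by positivity
    linarith)
  rw [heq, corrNorm_thetaMax x b hm] at hlt
  exact absurd (lt_of_mul_lt_mul_left hlt hm'.le) (not_lt.2 hle)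

theorem IsDualOptimal.activeSet_nonempty {x : Fin m → EuclideanSpace ℝ (Fin p)}
    {b : EuclideanSpace ℝ (Fin m)} (hb : ∀ i, b i = 1 ∨ b i = -1) (hm : 0 < m) {lam₀ : ℝ}
    (hpos : 0 < lam₀) (hle : lam₀ ≤ lambdaMax x b) {θ₀ : EuclideanSpace ℝ (Fin m)}
    (h : IsDualOptimal x b lam₀ θ₀) : (activeSet x b lam₀ θ₀).Nonempty := by
  have hml : 0 < m * lam₀ := mul_pos (Nat.cast_pos.2 hm) hpos
  by_contra hne
  have hne' : ∀ j, |inner ℝ θ₀ (xbarCol x b j)| ≠ m * lam₀ := fun j hj => hne ⟨j, hj⟩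
  have hcn := h.corrNorm_eq hb hm hle
  have hlt : corrNorm x b θ₀ < m * lam₀ := by
    rw [corrNorm, pi_norm_lt_iff hml]
    exact fun j => lt_of_le_of_ne ((corrNorm_le_iff hml.le).1 h.1.1 j) (hne' j)
  exact hlt.ne hcn

/-! ### The region containing the dual point -/

/-- The scaled point `(lam / lam₀) • θ₀` lies strictly inside the ball of the given radius. -/
theorem norm_smul_sub_lt_radius {lam₀ lam : ℝ} (hlam : 0 < lam) (hlt : lam < lam₀) (hm : 0 < m)
    {θ₀ : EuclideanSpace ℝ (Fin m)} (hθ : ∀ i, θ₀ i ∈ Ioo (0 : ℝ) 1) :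
    ‖(lam / lam₀) • θ₀ - θ₀‖ < radius lam₀ lam θ₀ := by
  have hm' : 0 < (m : ℝ) := Nat.cast_pos.2 hm
  have h0 : 0 < lam₀ := hlam.trans hlt
  have hs0 : 0 < lam / lam₀ := by positivity
  have hs1 : lam / lam₀ < 1 := (div_lt_one h0).2 hlt
  set s := lam / lam₀
  have hbox : ∀ i, (s • θ₀) i ∈ Ioo (0 : ℝ) 1 := fun i => by
    have := hθ i
    simp only [PiLp.smul_apply, smul_eq_mul]
    exact ⟨mul_pos hs0 this.1, by nlinarith [this.1, this.2]⟩
  have hne : s • θ₀ ≠ θ₀ := by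
    intro he
    have h1 : s * θ₀ ⟨0, hm⟩ = θ₀ ⟨0, hm⟩ := by
      conv_rhs => rw [← he]
      simp
    have := (hθ ⟨0, hm⟩).1
    nlinarith
  -- The bracket in `radius` is the Bregman divergence of `g` from `θ₀` to `s • θ₀`, so strict
  -- strong convexity is the whole claim.
  have h := dualObj_tangent_lt hθ hbox hne
  have e : s • θ₀ - θ₀ = -((1 - s) • θ₀) := by rw [sub_smul, one_smul]; abel
  rw [radius]
  refine Real.lt_sqrt_of_sq_lt ?_
  have e2 : inner ℝ (∇ dualObj θ₀) (s • θ₀ - θ₀) = -((1 - s) * inner ℝ (∇ dualObj θ₀) θ₀) := by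
    rw [e, inner_neg_right, real_inner_smul_right]
  rw [e2] at h
  rw [div_mul_eq_mul_div, ← lt_sub_iff_add_lt', div_lt_iff₀ hm'] at h
  change _ < (m : ℝ) / 2 * (dualObj (s • θ₀) - dualObj θ₀ + (1 - s) * inner ℝ (∇ dualObj θ₀) θ₀)
  linarith

/-- The region contains the dual point of every primal minimizer. -/
theorem dualPoint_mem_region {x : Fin m → EuclideanSpace ℝ (Fin p)}
    {b : EuclideanSpace ℝ (Fin m)} (hm : 0 < m) {lam₀ lam : ℝ} (hlam : 0 < lam)
    (hlt : lam < lam₀) {θ₀ : EuclideanSpace ℝ (Fin m)} (h₀ : IsDualOptimal x b lam₀ θ₀)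
    (j₀ : Fin p) {β : EuclideanSpace ℝ (Fin p)} {c : ℝ} (h : IsPrimalOptimal x b lam β c) :
    dualPoint x b β c ∈ region x b lam₀ lam θ₀ j₀ := by
  have hm' : 0 < (m : ℝ) := Nat.cast_pos.2 hm
  have h0 : 0 < lam₀ := hlam.trans hlt
  have hs0 : 0 < lam / lam₀ := by positivity
  have hs1 : lam / lam₀ < 1 := (div_lt_one h0).2 hlt
  have hsl : lam / lam₀ * lam₀ = lam := by field_simp
  have hsl' : (lam / lam₀)⁻¹ * lam = lam₀ := by field_simp
  -- Needed because `Real.sqrt` is `0` on negative numbers; a zero radius would contradict the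
  -- strict inclusion above.
  have hr : 0 ≤ (m : ℝ) / 2 * (dualObj ((lam / lam₀) • θ₀) - dualObj θ₀
      + (1 - lam / lam₀) * inner ℝ (∇ dualObj θ₀) θ₀) := by
    by_contra hneg
    have := norm_smul_sub_lt_radius hlam hlt hm h₀.1.2.2
    rw [radius, Real.sqrt_eq_zero_of_nonpos (not_le.1 hneg).le] at this
    exact absurd this (not_lt.2 (norm_nonneg _))
  set s := lam / lam₀
  set θ := dualPoint x b β c with hθ
  have hfeas : θ ∈ dualFeasible x b lam := h.dualPoint_mem hlam hm
  have hθc := (corrNorm_le_iff (by positivity)).1 hfeas.1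
  have hθ₀c := (corrNorm_le_iff (by positivity)).1 h₀.1.1
  have hsfeas : s • θ₀ ∈ dualFeasible x b lam := by
    refine ⟨(corrNorm_le_iff (by positivity)).2 fun j => ?_, ?_, fun i => ?_⟩
    · rw [real_inner_smul_left, abs_mul, abs_of_pos hs0]
      calc s * _ ≤ s * (m * lam₀) := mul_le_mul_of_nonneg_left (hθ₀c j) hs0.le
        _ = m * (s * lam₀) := by ring
        _ = m * lam := by rw [hsl]
    · rw [real_inner_smul_left, h₀.1.2.1, mul_zero]
    · have := h₀.1.2.2 i
      simp only [PiLp.smul_apply, smul_eq_mul]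
      exact ⟨mul_pos hs0 this.1, by nlinarith [this.1, this.2]⟩
  -- `s⁻¹ • θ` may leave the unit box, but only the linear constraints on the segment matter.
  have hgrad : 0 ≤ inner ℝ (∇ dualObj θ₀) (s⁻¹ • θ - θ₀) := by
    refine h₀.gradient_nonneg (by
      rw [inner_sub_left, real_inner_smul_left, hfeas.2.1, h₀.1.2.1]; simp) ?_
    filter_upwards [Ioo_mem_nhdsGT (zero_lt_one' ℝ)] with t ht
    refine (corrNorm_le_iff (by positivity)).2 fun j => ?_
    have e : θ₀ + t • (s⁻¹ • θ - θ₀) = (1 - t) • θ₀ + (t * s⁻¹) • θ := by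
      rw [smul_sub, sub_smul, one_smul, smul_smul]; abel
    rw [e, inner_add_left, real_inner_smul_left, real_inner_smul_left]
    refine (abs_add_le _ _).trans ?_
    rw [abs_mul, abs_mul, abs_of_pos (sub_pos.2 ht.2), abs_of_pos (mul_pos ht.1 (inv_pos.2 hs0))]
    calc _ ≤ (1 - t) * (m * lam₀) + (t * s⁻¹) * (m * lam) := by
          have : 0 ≤ 1 - t := (sub_pos.2 ht.2).le
          have : 0 ≤ t * s⁻¹ := (mul_pos ht.1 (inv_pos.2 hs0)).le
          gcongr
          · exact hθ₀c j
          · exact hθc j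
      _ = (1 - t) * (m * lam₀) + t * (m * (s⁻¹ * lam)) := by ring
      _ = m * lam₀ := by rw [hsl']; ring
  have hgrad' : 0 ≤ inner ℝ (∇ dualObj θ₀) (θ - θ₀) + (1 - s) * inner ℝ (∇ dualObj θ₀) θ₀ := by
    have := mul_nonneg hs0.le hgrad
    rw [inner_sub_right, real_inner_smul_right, mul_sub, ← mul_assoc,
      mul_inv_cancel₀ hs0.ne', one_mul] at this
    rw [inner_sub_right]
    linarith
  refine ⟨?_, hfeas.2.1, ?_⟩
  · rw [radius, Real.sq_sqrt hr]
    have h1 := h.dualObj_le hlam hm hsfeas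
    have h2 := dualObj_tangent_le h₀.1.2.2 hfeas.2.2
    have h3 : 0 ≤ 2 / (m : ℝ) * ‖s • θ₀ - θ‖ ^ 2 := by positivity
    have h4 : 2 / (m : ℝ) * ‖θ - θ₀‖ ^ 2
        ≤ dualObj (s • θ₀) - dualObj θ₀ + (1 - s) * inner ℝ (∇ dualObj θ₀) θ₀ := by linarith
    rw [div_mul_eq_mul_div, div_le_iff₀ hm'] at h4
    linarith
  · rw [xstar, real_inner_smul_right]
    refine (le_abs_self _).trans ?_
    rw [abs_mul]
    -- `j₀` is not assumed active here, so the sign may be `0`.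
    have : |Real.sign (inner ℝ θ₀ (xbarCol x b j₀))| ≤ 1 := by
      rcases Real.sign_apply_eq (inner ℝ θ₀ (xbarCol x b j₀)) with h | h | h <;> rw [h] <;> simp
    calc _ ≤ 1 * (m * lam) := mul_le_mul this (hθc j₀) (abs_nonneg _) zero_le_one
      _ = _ := one_mul _

theorem inner_xstar {x : Fin m → EuclideanSpace ℝ (Fin p)} {b : EuclideanSpace ℝ (Fin m)}
    {lam₀ : ℝ} {θ₀ : EuclideanSpace ℝ (Fin m)} {j₀ : Fin p}
    (hj₀ : j₀ ∈ activeSet x b lam₀ θ₀) : inner ℝ θ₀ (xstar x b θ₀ j₀) = m * lam₀ := by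
  have h : |inner ℝ θ₀ (xbarCol x b j₀)| = m * lam₀ := hj₀
  rw [xstar, real_inner_smul_right, ← h]
  rcases lt_trichotomy (inner ℝ θ₀ (xbarCol x b j₀)) 0 with h | h | h
  · rw [Real.sign_of_neg h, abs_of_neg h]; ring
  · rw [h]; simp
  · rw [Real.sign_of_pos h, abs_of_pos h]; ring

/-- The witness `(lam / lam₀) • θ₀` avoids appealing to a primal minimizer; the half-space
constraint is tight at it. -/
theorem region_nonempty {x : Fin m → EuclideanSpace ℝ (Fin p)} {b : EuclideanSpace ℝ (Fin m)}
    (hm : 0 < m) {lam₀ lam : ℝ} (hlam : 0 < lam) (hlt : lam < lam₀)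
    {θ₀ : EuclideanSpace ℝ (Fin m)} (h₀ : IsDualOptimal x b lam₀ θ₀) {j₀ : Fin p}
    (hj₀ : j₀ ∈ activeSet x b lam₀ θ₀) : (region x b lam₀ lam θ₀ j₀).Nonempty := by
  have h0 : lam₀ ≠ 0 := (hlam.trans hlt).ne'
  refine ⟨(lam / lam₀) • θ₀, ?_, ?_, ?_⟩
  · exact pow_le_pow_left₀ (norm_nonneg _) (norm_smul_sub_lt_radius hlam hlt hm h₀.1.2.2).le 2
  · rw [real_inner_smul_left, h₀.1.2.1, mul_zero]
  · rw [real_inner_smul_left, inner_xstar hj₀]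
    field_simp
    exact le_rfl

theorem isCompact_region (x : Fin m → EuclideanSpace ℝ (Fin p)) (b : EuclideanSpace ℝ (Fin m))
    (lam₀ lam : ℝ) (θ₀ : EuclideanSpace ℝ (Fin m)) (j₀ : Fin p) :
    IsCompact (region x b lam₀ lam θ₀ j₀) := by
  refine Metric.isCompact_of_isClosed_isBounded ?_ ?_
  · have h1 : IsClosed {θ : EuclideanSpace ℝ (Fin m) | ‖θ - θ₀‖ ^ 2 ≤ radius lam₀ lam θ₀ ^ 2} :=
      isClosed_le (by fun_prop) (by fun_prop)
    have h2 : IsClosed {θ : EuclideanSpace ℝ (Fin m) | inner ℝ θ b = 0} :=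
      isClosed_eq (by fun_prop) (by fun_prop)
    have h3 : IsClosed {θ : EuclideanSpace ℝ (Fin m) |
        inner ℝ θ (xstar x b θ₀ j₀) ≤ m * lam} :=
      isClosed_le (by fun_prop) (by fun_prop)
    exact h1.inter (h2.inter h3)
  · refine (Metric.isBounded_closedBall (x := θ₀) (r := radius lam₀ lam θ₀)).subset
      fun θ hθ => ?_
    rw [mem_closedBall_iff_norm]
    exact le_of_sq_le_sq hθ.1 (Real.sqrt_nonneg _)

theorem isGreatest_T {x : Fin m → EuclideanSpace ℝ (Fin p)} {b : EuclideanSpace ℝ (Fin m)}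
    {lam₀ lam : ℝ} {θ₀ : EuclideanSpace ℝ (Fin m)} {j₀ : Fin p}
    (hne : (region x b lam₀ lam θ₀ j₀).Nonempty) (ξ : ℝ) (j : Fin p) :
    IsGreatest (boundValues x b lam₀ lam θ₀ j₀ ξ j) (T x b lam₀ lam θ₀ j₀ ξ j) :=
  ((isCompact_region x b lam₀ lam θ₀ j₀).image (by fun_prop)).isGreatest_sSup (hne.image _)

/-- The features whose bounds are both below the threshold are inactive. -/
theorem IsPrimalOptimal.coeff_eq_zero_of_T_lt {x : Fin m → EuclideanSpace ℝ (Fin p)}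
    {b : EuclideanSpace ℝ (Fin m)} (hm : 0 < m) {lam₀ lam : ℝ} (hlam : 0 < lam)
    (hlt : lam < lam₀) {θ₀ : EuclideanSpace ℝ (Fin m)} (h₀ : IsDualOptimal x b lam₀ θ₀)
    {j₀ : Fin p} {β : EuclideanSpace ℝ (Fin p)} {c : ℝ} (h : IsPrimalOptimal x b lam β c)
    {j : Fin p} (hT : max (T x b lam₀ lam θ₀ j₀ 1 j) (T x b lam₀ lam θ₀ j₀ (-1) j) < m * lam) :
    β j = 0 := by
  have hmem := dualPoint_mem_region hm hlam hlt h₀ j₀ h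
  have h1 := (isGreatest_T ⟨_, hmem⟩ 1 j).2 (mem_image_of_mem _ hmem)
  have h2 := (isGreatest_T ⟨_, hmem⟩ (-1) j).2 (mem_image_of_mem _ hmem)
  simp only [one_smul, neg_smul, inner_neg_right] at h1 h2
  obtain ⟨h3, h4⟩ := max_lt_iff.1 hT
  refine h.coeff_eq_zero hlam hm (abs_lt.2 ⟨by linarith, by linarith⟩)

/-! ### The closed form of the maximum -/

theorem inner_proj_right {b θ : EuclideanSpace ℝ (Fin m)} (h : inner ℝ θ b = 0)
    (v : EuclideanSpace ℝ (Fin m)) : inner ℝ θ (proj b v) = inner ℝ θ v := by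
  rw [proj, inner_sub_right, real_inner_smul_right, h, mul_zero, sub_zero]

theorem inner_proj_label {b : EuclideanSpace ℝ (Fin m)} (v : EuclideanSpace ℝ (Fin m)) :
    inner ℝ (proj b v) b = 0 := by
  rw [proj, inner_sub_left, real_inner_smul_left, real_inner_self_eq_norm_sq]
  by_cases h : b = 0
  · simp [h]
  · have := norm_pos_iff.2 h
    field_simp
    ring

theorem proj_neg_smul (b v : EuclideanSpace ℝ (Fin m)) (ξ : ℝ) :
    proj b (-(ξ • v)) = -(ξ • proj b v) := by
  simp only [proj, inner_neg_left, real_inner_smul_left, smul_sub, smul_smul, neg_sub, neg_div,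
    neg_smul, mul_div_assoc]
  abel

/-- Upper bound for a linear functional on a ball cut by a half-space, by Lagrange relaxation. -/
theorem inner_le_lagrangian {E : Type*} [NormedAddCommGroup E] [InnerProductSpace ℝ E]
    {u w δ : E} {r D μ : ℝ} (hμ : 0 ≤ μ) (hδ : ‖δ‖ ≤ r) (hD : D ≤ inner ℝ δ w) :
    inner ℝ δ u ≤ r * ‖u + μ • w‖ - μ * D := by
  have h1 := real_inner_le_norm δ (u + μ • w)
  rw [inner_add_right, real_inner_smul_right] at h1
  have h2 := mul_le_mul_of_nonneg_right hδ (norm_nonneg (u + μ • w))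
  have h3 := mul_le_mul_of_nonneg_left hD hμ
  linarith

open Classical in
/-- The maximum of `⟨δ, u⟩` over the part of a ball of radius `r` cut off by `D ≤ ⟨δ, w⟩`. -/
theorem halfBall_max {E : Type*} [NormedAddCommGroup E] [InnerProductSpace ℝ E]
    {u w : E} {r D : ℝ} (hr : 0 < r) (hD : 0 < D) (hu : u ≠ 0) (hw : w ≠ 0)
    (hlt : D < r * ‖w‖) {d μ V : ℝ} (hd : d = D / (r * ‖w‖))
    (hμ : μ = (-(2 * inner ℝ u w * ‖w‖ ^ 2 * (1 - d ^ 2)) +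
      Real.sqrt ((2 * inner ℝ u w * ‖w‖ ^ 2 * (1 - d ^ 2)) ^ 2
        - 4 * (‖w‖ ^ 4 * (1 - d ^ 2)) *
          ((inner ℝ u w) ^ 2 - d ^ 2 * ‖u‖ ^ 2 * ‖w‖ ^ 2))) / (2 * (‖w‖ ^ 4 * (1 - d ^ 2))))
    (hV : V = if d ≤ inner ℝ u w / (‖u‖ * ‖w‖) then r * ‖u‖ else r * ‖u + μ • w‖ - μ * D) :
    (∃ s t : ℝ, ‖s • u + t • w‖ ≤ r ∧ D ≤ inner ℝ (s • u + t • w) w ∧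
      inner ℝ (s • u + t • w) u = V) ∧
    ∀ δ : E, ‖δ‖ ≤ r → D ≤ inner ℝ δ w → inner ℝ δ u ≤ V := by
  have hu' := norm_pos_iff.2 hu
  have hw' := norm_pos_iff.2 hw
  have hDd : D = d * (r * ‖w‖) := by rw [hd]; field_simp
  have hd0 : 0 < d := by rw [hd]; positivity
  -- The cutting plane meets the interior of the ball, which makes the leading coefficient `a₂`
  -- positive.
  have hd1 : d < 1 := by rw [hd, div_lt_one (by positivity)]; exact hlt
  have hd2 : 0 < 1 - d ^ 2 := by nlinarith
  have hcs := real_inner_mul_inner_self_le u w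
  rw [real_inner_self_eq_norm_sq, real_inner_self_eq_norm_sq] at hcs
  -- In this case the maximizer over the full ball, `(r / ‖u‖) • u`, already satisfies the
  -- half-space constraint.
  by_cases hc : d ≤ inner ℝ u w / (‖u‖ * ‖w‖)
  · rw [if_pos hc] at hV
    subst hV
    rw [le_div_iff₀ (by positivity)] at hc
    refine ⟨⟨r / ‖u‖, 0, ?_, ?_, ?_⟩, fun δ hδ _ => ?_⟩
    · rw [zero_smul, add_zero, norm_smul, Real.norm_of_nonneg (by positivity)]
      field_simp
      exact le_rfl
    · rw [zero_smul, add_zero, real_inner_smul_left, hDd, div_mul_eq_mul_div,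
        le_div_iff₀ hu']
      nlinarith
    · rw [zero_smul, add_zero, real_inner_smul_left, real_inner_self_eq_norm_sq]
      field_simp
    · exact (real_inner_le_norm _ _).trans (mul_le_mul_of_nonneg_right hδ hu'.le)
  -- Now the constraint binds. The multiplier must satisfy `q + μW² = dW‖u + μw‖`, i.e. `r(u +
  -- μw)/‖u + μw‖` lies on the cutting plane. Squaring gives `a₂μ² + a₁μ + a₀ = 0`, and the larger
  -- root keeps the left side nonnegative.
  · rw [if_neg hc] at hV
    rw [le_div_iff₀ (by positivity), not_le] at hc
    set q := inner ℝ u w with hq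
    set W := ‖w‖ with hW
    set U := ‖u‖ with hU
    -- the reduced discriminant
    have hΔ : (2 * q * W ^ 2 * (1 - d ^ 2)) ^ 2
        - 4 * (W ^ 4 * (1 - d ^ 2)) * (q ^ 2 - d ^ 2 * U ^ 2 * W ^ 2)
        = (2 * W ^ 2 * d) ^ 2 * ((1 - d ^ 2) * (U ^ 2 * W ^ 2 - q ^ 2)) := by ring
    have hQ : 0 ≤ (1 - d ^ 2) * (U ^ 2 * W ^ 2 - q ^ 2) :=
      mul_nonneg hd2.le (by linarith)
    rw [hΔ, Real.sqrt_mul (sq_nonneg _), Real.sqrt_sq (by positivity)] at hμ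
    set S := Real.sqrt ((1 - d ^ 2) * (U ^ 2 * W ^ 2 - q ^ 2)) with hS
    have hS0 : 0 ≤ S := Real.sqrt_nonneg _
    have hS2 : S ^ 2 = (1 - d ^ 2) * (U ^ 2 * W ^ 2 - q ^ 2) := Real.sq_sqrt hQ
    have hμ1 : (q + μ * W ^ 2) * (1 - d ^ 2) = d * S := by
      rw [hμ]
      field_simp
      ring
    have hin : inner ℝ (u + μ • w) w = q + μ * W ^ 2 := by
      rw [inner_add_left, real_inner_smul_left, real_inner_self_eq_norm_sq]
    have hin0 : 0 ≤ q + μ * W ^ 2 := by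
      have : 0 ≤ (q + μ * W ^ 2) * (1 - d ^ 2) := by rw [hμ1]; positivity
      exact nonneg_of_mul_nonneg_left this hd2
    have hnsq : ‖u + μ • w‖ ^ 2 = U ^ 2 + 2 * μ * q + μ ^ 2 * W ^ 2 := by
      rw [norm_add_sq_real, real_inner_smul_right, norm_smul, mul_pow, Real.norm_eq_abs, sq_abs]
      ring
    have hsq : (q + μ * W ^ 2) ^ 2 = (d * W * ‖u + μ • w‖) ^ 2 := by
      rw [mul_pow, hnsq]
      have h1 : ((q + μ * W ^ 2) * (1 - d ^ 2)) ^ 2 = d ^ 2 * S ^ 2 := by rw [hμ1]; ring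
      rw [hS2] at h1
      have h2 : (q + μ * W ^ 2) ^ 2 * (1 - d ^ 2) = d ^ 2 * (U ^ 2 * W ^ 2 - q ^ 2) := by
        apply mul_right_cancel₀ hd2.ne'
        linarith
      linear_combination h2
    have hstat : q + μ * W ^ 2 = d * W * ‖u + μ • w‖ :=
      (pow_left_inj₀ hin0 (by positivity) two_ne_zero).1 hsq
    have hμ0 : 0 < μ := by
      rcases lt_or_ge q 0 with hq0 | hq0
      · by_contra hle
        linarith [mul_nonpos_of_nonpos_of_nonneg (not_lt.1 hle) (sq_nonneg W)]
      · have hlt' : q * (1 - d ^ 2) < d * S := by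
          apply lt_of_pow_lt_pow_left₀ 2 (by positivity)
          rw [mul_pow, mul_pow, hS2]
          have : q ^ 2 < (d * (U * W)) ^ 2 := pow_lt_pow_left₀ hc hq0 two_ne_zero
          linarith [mul_pos hd2 (sub_pos.2 this)]
        have : 0 < μ * (W ^ 2 * (1 - d ^ 2)) := by linarith
        exact pos_of_mul_pos_left this (by positivity)
    refine ⟨?_, fun δ h1 h2 => hV ▸ inner_le_lagrangian hμ0.le h1 h2⟩
    -- Degenerate case: `u` is antiparallel to `w`, so every point of the cutting plane inside the
    -- ball is optimal.
    by_cases hz : u + μ • w = 0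
    · rw [hz, norm_zero, mul_zero, zero_sub] at hV
      have hum : u = -(μ • w) := eq_neg_of_add_eq_zero_left hz
      refine ⟨0, D / W ^ 2, ?_, ?_, ?_⟩
      · rw [zero_smul, zero_add, norm_smul, Real.norm_of_nonneg (by positivity),
          div_mul_eq_mul_div, div_le_iff₀ (by positivity)]
        linarith [mul_le_mul_of_nonneg_right hlt.le hw'.le]
      · rw [zero_smul, zero_add, real_inner_smul_left, real_inner_self_eq_norm_sq]
        field_simp
        exact le_rfl
      · rw [zero_smul, zero_add, real_inner_smul_left, hum, inner_neg_right,
          real_inner_smul_right, real_inner_self_eq_norm_sq, hV, ← hW]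
        field_simp
    · have hN := norm_pos_iff.2 hz
      set N := ‖u + μ • w‖ with hNdef
      have e : (r / N) • u + (r / N * μ) • w = (r / N) • (u + μ • w) := by
        rw [smul_add, smul_smul]
      refine ⟨r / N, r / N * μ, ?_, ?_, ?_⟩
      · rw [e, norm_smul, Real.norm_of_nonneg (by positivity), ← hNdef]
        field_simp
        exact le_rfl
      · rw [e, real_inner_smul_left, hin, hstat, hDd]
        field_simp
        exact le_rfl
      · have h1 : inner ℝ (u + μ • w) (u + μ • w) = N ^ 2 := real_inner_self_eq_norm_sq _
        rw [inner_add_right, real_inner_smul_right, hin, hstat] at h1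
        rw [e, real_inner_smul_left, hV, hDd]
        have h2 : inner ℝ (u + μ • w) u = N ^ 2 - μ * (d * W * N) := by linarith
        rw [h2]
        field_simp

/-- Substituting `δ = θ₀ - θ` centres the ball at `0` and turns the half-space into `m(lam₀ - lam) ≤
⟨δ, w⟩`. The maximizer from `halfBall_max` lies in the span of `u` and `w`, hence in the label
hyperplane. -/
theorem T_eq_closedForm {x : Fin m → EuclideanSpace ℝ (Fin p)} {b : EuclideanSpace ℝ (Fin m)}
    (hm : 0 < m) {lam₀ lam : ℝ} (hlam : 0 < lam) (hlt : lam < lam₀)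
    {θ₀ : EuclideanSpace ℝ (Fin m)} (h₀ : IsDualOptimal x b lam₀ θ₀) {j₀ : Fin p}
    (hj₀ : j₀ ∈ activeSet x b lam₀ θ₀) {ξ : ℝ} (hξ : ξ ≠ 0) {j : Fin p}
    (hj : proj b (xbarCol x b j) ≠ 0) :
    T x b lam₀ lam θ₀ j₀ ξ j = closedForm x b lam₀ lam θ₀ j₀ ξ j := by
  have hm' : 0 < (m : ℝ) := Nat.cast_pos.2 hm
  have h0 : 0 < lam₀ := hlam.trans hlt
  have hlr := norm_smul_sub_lt_radius hlam hlt hm h₀.1.2.2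
  have hr : 0 < radius lam₀ lam θ₀ := (norm_nonneg _).trans_lt hlr
  have hsl : lam / lam₀ * lam₀ = lam := by field_simp
  set xb := -(ξ • xbarCol x b j) with hxb
  set u := proj b xb with hu
  set w := proj b (xstar x b θ₀ j₀) with hw
  have hu0 : u ≠ 0 := by
    rw [hu, hxb, proj_neg_smul]
    exact neg_ne_zero.2 (smul_ne_zero hξ hj)
  have hθw : inner ℝ θ₀ w = m * lam₀ := by
    rw [hw, inner_proj_right h₀.1.2.1, inner_xstar hj₀]
  have hw0 : w ≠ 0 := by
    intro h
    rw [h, inner_zero_right] at hθw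
    exact absurd hθw (by positivity)
  have hD : 0 < m * (lam₀ - lam) := mul_pos hm' (sub_pos.2 hlt)
  -- Cauchy–Schwarz for `θ₀ - (lam / lam₀) • θ₀`, which is strictly inside the ball and on the
  -- cutting plane.
  have hDlt : m * (lam₀ - lam) < radius lam₀ lam θ₀ * ‖w‖ := by
    have h1 : inner ℝ (θ₀ - (lam / lam₀) • θ₀) w = m * (lam₀ - lam) := by
      rw [inner_sub_left, real_inner_smul_left, hθw]
      linear_combination (-(m : ℝ)) * hsl
    rw [← h1]
    refine (real_inner_le_norm _ _).trans_lt ?_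
    rw [norm_sub_rev]
    exact mul_lt_mul_of_pos_right hlr (norm_pos_iff.2 hw0)
  obtain ⟨⟨s, t, hs1, hs2, hs3⟩, hmax⟩ := halfBall_max hr hD hu0 hw0 hDlt rfl rfl rfl
  have hcl : closedForm x b lam₀ lam θ₀ j₀ ξ j = inner ℝ (s • u + t • w) u - inner ℝ θ₀ xb := by
    rw [hs3]
    simp only [closedForm]
    rw [← hxb, ← hu, ← hw]
    split_ifs
    · rfl
    · rw [mul_assoc _ (m : ℝ) (lam₀ - lam)]
  have hval : ∀ δ : EuclideanSpace ℝ (Fin m), inner ℝ δ b = 0 →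
      inner ℝ (θ₀ - δ) (ξ • xbarCol x b j) = inner ℝ δ u - inner ℝ θ₀ xb := by
    intro δ hδ
    rw [hu, inner_proj_right hδ, hxb, inner_neg_right, inner_neg_right, inner_sub_left]
    ring
  have hreg : ∀ δ : EuclideanSpace ℝ (Fin m), inner ℝ δ b = 0 →
      (inner ℝ (θ₀ - δ) (xstar x b θ₀ j₀) ≤ m * lam ↔ m * (lam₀ - lam) ≤ inner ℝ δ w) := by
    intro δ hδ
    rw [hw, inner_proj_right hδ, inner_sub_left, inner_xstar hj₀]
    constructor <;> intro h <;> linarith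
  rw [hcl]
  refine IsGreatest.csSup_eq ⟨⟨θ₀ - (s • u + t • w), ⟨?_, ?_, ?_⟩, ?_⟩, ?_⟩
  · rw [sub_sub_cancel_left, norm_neg]
    exact pow_le_pow_left₀ (norm_nonneg _) hs1 2
  · rw [inner_sub_left, inner_add_left, real_inner_smul_left, real_inner_smul_left, hu, hw,
      inner_proj_label, inner_proj_label, h₀.1.2.1]
    simp
  · refine (hreg _ ?_).2 hs2
    rw [inner_add_left, real_inner_smul_left, real_inner_smul_left, hu, hw,
      inner_proj_label, inner_proj_label]
    simp
  · refine hval _ ?_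
    rw [inner_add_left, real_inner_smul_left, real_inner_smul_left, hu, hw,
      inner_proj_label, inner_proj_label]
    simp
  · rintro _ ⟨θ, hθ, rfl⟩
    have hδ : inner ℝ (θ₀ - θ) b = 0 := by rw [inner_sub_left, h₀.1.2.1, hθ.2.1, sub_zero]
    have e : θ = θ₀ - (θ₀ - θ) := (sub_sub_cancel _ _).symm
    have h1 : ‖θ₀ - θ‖ ≤ radius lam₀ lam θ₀ := by
      rw [norm_sub_rev]
      exact le_of_sq_le_sq hθ.1 hr.le
    have h2 := hθ.2.2
    rw [e, hreg _ hδ] at h2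
    have h3 := hmax _ h1 h2
    rw [← hs3] at h3
    change inner ℝ θ (ξ • xbarCol x b j) ≤ _
    rw [e, hval _ hδ]
    linarith

end Slores

end

theorem theorem9 (m p : ℕ) (x : Fin m → EuclideanSpace ℝ (Fin p))
    (b : EuclideanSpace ℝ (Fin m)) (hb : ∀ i, b i = 1 ∨ b i = -1)
    (lam : ℝ) (hlam : 0 < lam) :
    -- Part 1: above the threshold every primal solution vanishes.
    (Slores.lambdaMax x b ≤ lam →
      ∀ (β : EuclideanSpace ℝ (Fin p)) (c : ℝ),
        Slores.IsPrimalOptimal x b lam β c → β = 0) ∧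
    -- Part 2: the screening rule.
    (∀ (lam₀ : ℝ) (θ₀ : EuclideanSpace ℝ (Fin m)),
      lam < lam₀ → lam₀ ≤ Slores.lambdaMax x b → Slores.IsDualOptimal x b lam₀ θ₀ →
      -- an active index, needed to define the region, exists
      (Slores.activeSet x b lam₀ θ₀).Nonempty ∧
      ∀ j : Fin p,
        -- (a)
        (Slores.proj b (Slores.xbarCol x b j) = 0 →
          ∀ (β : EuclideanSpace ℝ (Fin p)) (c : ℝ),
            Slores.IsPrimalOptimal x b lam β c → β j = 0) ∧
        -- for every choice of the active index:
        ∀ j₀ ∈ Slores.activeSet x b lam₀ θ₀,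
          -- the maximum defining `T_ξ` is attained, and has the closed form
          (∀ ξ : ℝ, ξ = 1 ∨ ξ = -1 →
            IsGreatest (Slores.boundValues x b lam₀ lam θ₀ j₀ ξ j)
              (Slores.T x b lam₀ lam θ₀ j₀ ξ j) ∧
            (Slores.proj b (Slores.xbarCol x b j) ≠ 0 →
              Slores.T x b lam₀ lam θ₀ j₀ ξ j = Slores.closedForm x b lam₀ lam θ₀ j₀ ξ j)) ∧
          -- (b)
          (max (Slores.T x b lam₀ lam θ₀ j₀ 1 j) (Slores.T x b lam₀ lam θ₀ j₀ (-1) j)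
              < m * lam →
            ∀ (β : EuclideanSpace ℝ (Fin p)) (c : ℝ),
              Slores.IsPrimalOptimal x b lam β c → β j = 0)) := by
  refine ⟨fun hle β c h => h.eq_zero_of_lambdaMax_le hb hlam hle, ?_⟩
  intro lam₀ θ₀ hlt hle h₀
  have hm : 0 < m := by
    -- For `m = 0` division by zero makes `lambdaMax` equal to `0`, contradicting `0 < lam < lam₀`.
    rcases Nat.eq_zero_or_pos m with rfl | hm
    · simp only [Slores.lambdaMax, Nat.cast_zero, div_zero, zero_mul] at hle
      linarith
    · exact hm
  have hm' : 0 < (m : ℝ) := Nat.cast_pos.2 hm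
  refine ⟨h₀.activeSet_nonempty hb hm (hlam.trans hlt) hle, fun j => ⟨?_, ?_⟩⟩
  · intro hj β c h
    refine h.coeff_eq_zero hlam hm ?_
    rw [← Slores.inner_proj_right (h.inner_label hlam hm), hj, inner_zero_right, abs_zero]
    positivity
  · intro j₀ hj₀
    refine ⟨fun ξ hξ => ⟨?_, fun hj => ?_⟩, fun hT β c h => ?_⟩
    · exact Slores.isGreatest_T (Slores.region_nonempty hm hlam hlt h₀ hj₀) ξ j
    · refine Slores.T_eq_closedForm hm hlam hlt h₀ hj₀ ?_ hj
      rcases hξ with rfl | rfl <;> norm_num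
    · exact h.coeff_eq_zero_of_T_lt hm hlam hlt h₀ hT
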